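/- There is an absolute constant $c>0$ such that the following holds. Let $H$ be a finite $3$-uniform hypergraph (without repeated edges) with $m\ge 2$ edges, and let $D$ be its maximum co-degree, that is, the largest number of edges of $H$ containing a given pair of distinct vertices. Then $$\mathrm{surp}_3(H)\;\ge\; c\,\frac{m^{3/4}}{D^{3/4}(\log m)^2}.$$ Here $\mathrm{surp}_3(H)=\mathrm{mc}_3(H)-\frac{2}{9}m$, where $\mathrm{mc}_3(H)$ is the maximum, over all partitions of the vertex set of $H$ into three (possibly empty) parts $V_1,V_2,V_3$, of the number of edges having exactly one vertex in each part; and $\frac{2}{9}m=\frac{S(3,3)\,3!}{3^3}m$ is the expected number of such edges for a uniformly random partition. -/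

import Mathlib

namespace Hypergraph

/-- `H` is `r`-uniform: every edge has exactly `r` vertices (an `r`-graph). Edges form a set, so
there are no repeated edges. (For `0 < r` every edge is then a finite set.) -/
def IsUniform {α : Type*} (H : Hypergraph α) (r : ℕ) : Prop :=
  ∀ e ∈ H.edgeSet, e.ncard = r

/-- The number of edges of `H`. -/
noncomputable def numEdges {α : Type*} (H : Hypergraph α) : ℕ := H.edgeSet.ncard

/-- The co-degree of `u` and `v`: the number of edges containing both of them. -/
noncomputable def codegree {α : Type*} (H : Hypergraph α) (u v : α) : ℕ :=
  {e ∈ H.edgeSet | u ∈ e ∧ v ∈ e}.ncard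

/-- The maximum co-degree: the largest co-degree of a pair of distinct vertices. -/
noncomputable def maxCodegree {α : Type*} (H : Hypergraph α) : ℕ :=
  sSup {d : ℕ | ∃ u ∈ H.vertexSet, ∃ v ∈ H.vertexSet, u ≠ v ∧ H.codegree u v = d}

/-- The set of edges of the `k`-cut given by the partition of the vertices into the parts
`{v | f v = i}`, `i : Fin k`: the edges having at least one vertex in each part. -/
def cutEdges {α : Type*} (H : Hypergraph α) {k : ℕ} (f : α → Fin k) : Set (Set α) :=
  {e ∈ H.edgeSet | ∀ i : Fin k, ∃ v ∈ e, f v = i}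

/-- Max-`k`-Cut: the maximum size of a `k`-cut of `H`. -/
noncomputable def maxCut {α : Type*} (H : Hypergraph α) (k : ℕ) : ℕ :=
  sSup {s : ℕ | ∃ f : α → Fin k, (H.cutEdges f).ncard = s}

/-- The `k`-surplus of an `r`-graph `H`: the excess of the maximum `k`-cut over the expected size
`S(r,k) k! / k ^ r * e(H)` of a uniformly random `k`-cut. -/
noncomputable def surplus {α : Type*} (H : Hypergraph α) (r k : ℕ) : ℝ :=
  (H.maxCut k : ℝ) -
    ((Nat.stirlingSecond r k : ℝ) * (Nat.factorial k : ℝ) / (k : ℝ) ^ r) * (H.numEdges : ℝ)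

theorem finite_edgeSet {α : Type*} {H : Hypergraph α} (hV : H.vertexSet.Finite) :
    H.edgeSet.Finite :=
  hV.finite_subsets.subset fun _ he => H.subset_vertexSet_of_mem_edgeSet' he

theorem ncard_cutEdges_le_maxCut {α : Type*} {H : Hypergraph α} (hV : H.vertexSet.Finite)
    {k : ℕ} (f : α → Fin k) : (H.cutEdges f).ncard ≤ H.maxCut k := by
  refine le_csSup ⟨H.numEdges, ?_⟩ ⟨f, rfl⟩
  rintro _ ⟨g, rfl⟩
  exact Set.ncard_le_ncard (fun e he => he.1) (finite_edgeSet hV)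

theorem exists_ncard_cutEdges_eq_maxCut {α : Type*} {H : Hypergraph α}
    (hV : H.vertexSet.Finite) {k : ℕ} (hk : 0 < k) :
    ∃ f : α → Fin k, (H.cutEdges f).ncard = H.maxCut k := by
  refine Nat.sSup_mem (s := {s : ℕ | ∃ f : α → Fin k, (H.cutEdges f).ncard = s})
    ⟨_, fun _ => ⟨0, hk⟩, rfl⟩ ⟨H.numEdges, ?_⟩
  rintro _ ⟨g, rfl⟩
  exact Set.ncard_le_ncard (fun e he => he.1) (finite_edgeSet hV)

theorem codegree_le_maxCodegree {α : Type*} {H : Hypergraph α} (hV : H.vertexSet.Finite)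
    {u v : α} (hu : u ∈ H.vertexSet) (hv : v ∈ H.vertexSet) (huv : u ≠ v) :
    H.codegree u v ≤ H.maxCodegree := by
  refine le_csSup ⟨H.numEdges, ?_⟩ ⟨u, hu, v, hv, huv, rfl⟩
  rintro _ ⟨_, _, _, _, _, rfl⟩
  exact Set.ncard_le_ncard (fun e he => he.1) (finite_edgeSet hV)

end Hypergraph

/-! A random colouring with independent, vertex-dependent colour distributions can be derandomised,
so any choice of distributions bounds the maximum cut from below. Perturb the uniform distribution
by `x` along `(0, 1, -1)` and by `q` along `(-2, 1, 1)`; mixing two scalings of `q` leaves a form in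
`xx`, `qxx` and `qq` only (`surplus_ge_form`).

Take `x` to be random signs, and `q u` the sum of the products `x v * x w` over the link of `u` in a
linear subfamily `J`, divided by a scale `T`. On average over the signs the `xx` terms vanish, the
`qq` terms vanish by linearity of `J`, and the `qxx` terms are nonnegative on every edge and
contribute of order `#J / T`. Hence edges outside `J` do no harm.

The constraint `|q| ≤ 1/6` needs `T` above the typical size of a link sum. Links in a linear family
are matchings, so link sums are sub-Gaussian with variance the degree. Only vertices of degree at
most `3√#J` are used, and these carry half of the incidences (`card_low_incidences_ge`). Thus `T` of
order `(#J)^(1/4) * √(log m)` suffices, and a maximal linear `J` has at least `m / (3D)` edges. -/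

namespace ThreeCut

open Finset

/-! ### Derandomisation and the perturbed colour distributions -/

section

/-- The permanent of the `3 × 3` matrix with rows `p`, `q`, `r`: the probability that three
independent colours with distributions `p`, `q`, `r` are all different. -/
def rainbowProb (p q r : Fin 3 → ℝ) : ℝ :=
  p 0 * (q 1 * r 2 + q 2 * r 1) + p 1 * (q 0 * r 2 + q 2 * r 0) + p 2 * (q 0 * r 1 + q 1 * r 0)

theorem rainbowProb_single_le (c : Fin 3 → Fin 3) [Decidable (Function.Surjective c)] :
    rainbowProb (Pi.single (c 0) 1) (Pi.single (c 1) 1) (Pi.single (c 2) 1) ≤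
      if Function.Surjective c then 1 else 0 := by
  have key : ∀ i j k : Fin 3, (i ≠ j ∧ i ≠ k ∧ j ≠ k →
      rainbowProb (Pi.single i 1) (Pi.single j 1) (Pi.single k 1) ≤ 1) ∧
      (¬ (i ≠ j ∧ i ≠ k ∧ j ≠ k) →
      rainbowProb (Pi.single i 1) (Pi.single j 1) (Pi.single k 1) ≤ 0) := by
    intro i j k
    fin_cases i <;> fin_cases j <;> fin_cases k <;> simp [rainbowProb]
  split_ifs with h
  · have hi : Function.Injective c := Finite.injective_iff_surjective.2 h
    exact (key _ _ _).1 ⟨hi.ne (by decide), hi.ne (by decide), hi.ne (by decide)⟩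
  · refine (key _ _ _).2 fun hd => h (Finite.injective_iff_surjective.1 ?_)
    obtain ⟨h1, h2, h3⟩ := hd
    intro i j hij
    fin_cases i <;> fin_cases j <;> simp_all

variable {V ι : Type*} [DecidableEq V] [Fintype ι]

/-- The expected number of rainbow triples when each vertex `v` receives an independent colour
with distribution `π v`. -/
def expectedCut (a : ι → Fin 3 → V) (π : V → Fin 3 → ℝ) : ℝ :=
  ∑ i, rainbowProb (π (a i 0)) (π (a i 1)) (π (a i 2))

/-- Injectivity puts `v` at most once in each triple, so every summand is affine in `π v`. -/
theorem expectedCut_eq_sum_update {a : ι → Fin 3 → V} (ha : ∀ i, Function.Injective (a i))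
    (π : V → Fin 3 → ℝ) (v : V) (hv : ∑ c, π v c = 1) :
    expectedCut a π =
      ∑ c, π v c * expectedCut a (Function.update π v (Pi.single c 1)) := by
  simp only [expectedCut, mul_sum]
  rw [sum_comm]
  refine sum_congr rfl fun i _ => ?_
  have h01 : a i 0 ≠ a i 1 := (ha i).ne (by decide)
  have h02 : a i 0 ≠ a i 2 := (ha i).ne (by decide)
  have h12 : a i 1 ≠ a i 2 := (ha i).ne (by decide)
  by_cases h0 : a i 0 = v
  · subst h0
    simp [h01.symm, h02.symm, Fin.sum_univ_three, rainbowProb, Pi.single_apply]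
  by_cases h1 : a i 1 = v
  · subst h1
    simp [h01, h12.symm, Fin.sum_univ_three, rainbowProb, Pi.single_apply]
    ring
  by_cases h2 : a i 2 = v
  · subst h2
    simp [h02, h12, Fin.sum_univ_three, rainbowProb, Pi.single_apply]
    ring
  simp only [Function.update_of_ne h0, Function.update_of_ne h1, Function.update_of_ne h2]
  rw [← sum_mul, hv, one_mul]

theorem exists_update_ge {a : ι → Fin 3 → V} (ha : ∀ i, Function.Injective (a i))
    (π : V → Fin 3 → ℝ) (v : V) (h0 : ∀ c, 0 ≤ π v c) (hv : ∑ c, π v c = 1) :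
    ∃ c, expectedCut a π ≤ expectedCut a (Function.update π v (Pi.single c 1)) := by
  by_contra! h
  have h1 : ∑ c, π v c * expectedCut a (Function.update π v (Pi.single c 1)) <
      ∑ c, π v c * expectedCut a π := by
    refine sum_lt_sum (fun c _ => mul_le_mul_of_nonneg_left (h c).le (h0 c)) ?_
    obtain ⟨c, -, hc⟩ := exists_lt_of_sum_lt (s := univ) (f := fun _ : Fin 3 => (0 : ℝ))
      (g := π v) (by simp [hv])
    exact ⟨c, mem_univ c, mul_lt_mul_of_pos_left (h c) hc⟩
  rw [← expectedCut_eq_sum_update ha π v hv, ← sum_mul, hv, one_mul] at h1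
  exact lt_irrefl _ h1

open Classical in
/-- The number of triples on which `f` takes all three colours. -/
noncomputable def cutSize (a : ι → Fin 3 → V) (f : V → Fin 3) : ℕ :=
  #{i | Function.Surjective (f ∘ a i)}

/-- Method of conditional expectations: the vertices are fixed one at a time, never lowering the
expectation. -/
theorem exists_cutSize_ge [Fintype V] {a : ι → Fin 3 → V} (ha : ∀ i, Function.Injective (a i))
    (π : V → Fin 3 → ℝ) (h0 : ∀ v c, 0 ≤ π v c) (h1 : ∀ v, ∑ c, π v c = 1) :
    ∃ f, expectedCut a π ≤ cutSize a f := by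
  have key : ∀ S : Finset V, ∃ f : V → Fin 3,
      expectedCut a π ≤ expectedCut a fun v => if v ∈ S then Pi.single (f v) 1 else π v := by
    intro S
    induction S using Finset.induction_on with
    | empty => exact ⟨fun _ => 0, by simp⟩
    | insert v S hv ih =>
      obtain ⟨f, hf⟩ := ih
      obtain ⟨c, hc⟩ := exists_update_ge ha
        (fun v => if v ∈ S then Pi.single (f v) 1 else π v) v (by simp [hv, h0]) (by simp [hv, h1])
      refine ⟨Function.update f v c, hf.trans (hc.trans (le_of_eq ?_))⟩
      congr 1
      funext w
      by_cases hw : w = v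
      · subst hw; simp
      · simp [hw]
  obtain ⟨f, hf⟩ := key univ
  refine ⟨f, hf.trans ?_⟩
  classical
  simp only [expectedCut, mem_univ, if_true, cutSize, card_filter, Nat.cast_sum]
  refine sum_le_sum fun i _ => ?_
  have := rainbowProb_single_le (f ∘ a i)
  simpa using this

/-- The lower bound for the surplus obtained by averaging two colourings in which the cubic
terms cancel. -/
theorem surplus_ge_form [Fintype V] {a : ι → Fin 3 → V} (ha : ∀ i, Function.Injective (a i))
    {M : ℝ} (hM : ∀ f, (cutSize a f : ℝ) - 2 / 9 * Fintype.card ι ≤ M)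
    (x q : V → ℝ) (hx : ∀ v, |x v| ≤ 1) (hq : ∀ v, |q v| ≤ 1 / 6) :
    -(1 / 54) * ∑ i, ∑ k, x (a i (k + 1)) * x (a i (k + 2)) +
      ((1 / 27) * ∑ i, ∑ k, q (a i k) * (x (a i (k + 1)) * x (a i (k + 2))) -
        (2 / 3) * ∑ i, ∑ k, q (a i (k + 1)) * q (a i (k + 2))) ≤ M := by
  -- Both directions sum to zero, so no linear terms arise. Exchanging colours 1 and 2 negates `x`,
  -- which kills `qx`, `xxx` and `qqx`.
  let π : ℝ → V → Fin 3 → ℝ := fun ε v =>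
    ![1 / 3 + 2 * (-ε * q v), 1 / 3 - (-ε * q v) + x v / 6, 1 / 3 - (-ε * q v) - x v / 6]
  have hπ : ∀ ε, |ε| ≤ 1 → expectedCut a (π ε) - 2 / 9 * Fintype.card ι ≤ M := by
    intro ε hε
    obtain ⟨f, hf⟩ := exists_cutSize_ge ha (π ε) (fun v c => by
      have h1 : |(-ε * q v)| ≤ 1 / 6 := by
        rw [abs_mul, abs_neg]
        calc |ε| * |q v| ≤ 1 * (1 / 6) := mul_le_mul hε (hq v) (abs_nonneg _) zero_le_one
          _ = 1 / 6 := one_mul _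
      have h2 := abs_le.1 h1
      have h3 := abs_le.1 (hx v)
      fin_cases c <;> simp only [π] <;> simp <;> linarith)
      (fun v => by simp [π, Fin.sum_univ_three]; ring)
    linarith [hM f]
  -- With weights `8/9` and `1/9`, these two values of `ε` have first and second moments `1/3` and
  -- third moment `0`, which removes `qqq`.
  have hA := hπ (1 / 2) (by norm_num [abs_of_pos])
  have hB := hπ (-1) (by norm_num)
  have e : ∀ i : ι,
      -(1 / 54) * ∑ k, x (a i (k + 1)) * x (a i (k + 2)) +
      ((1 / 27) * ∑ k, q (a i k) * (x (a i (k + 1)) * x (a i (k + 2))) -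
        (2 / 3) * ∑ k, q (a i (k + 1)) * q (a i (k + 2))) =
      8 / 9 * (rainbowProb (π (1 / 2) (a i 0)) (π (1 / 2) (a i 1)) (π (1 / 2) (a i 2)) - 2 / 9) +
      1 / 9 * (rainbowProb (π (-1) (a i 0)) (π (-1) (a i 1)) (π (-1) (a i 2)) - 2 / 9) := by
    intro i
    have f1 : (1 : Fin 3) + 1 = 2 := rfl
    have f2 : (1 : Fin 3) + 2 = 0 := rfl
    have f3 : (2 : Fin 3) + 1 = 0 := rfl
    have f4 : (2 : Fin 3) + 2 = 1 := rfl
    simp only [Fin.sum_univ_three, zero_add, f1, f2, f3, f4, rainbowProb, π]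
    simp
    ring
  have e' := Finset.sum_congr (rfl : (univ : Finset ι) = univ) fun i _ => e i
  simp only [sum_add_distrib, sum_sub_distrib, ← mul_sum, sum_const, card_univ, nsmul_eq_mul] at e'
  simp only [expectedCut] at hA hB
  linarith

end

/-! ### Random signs: correlations and tail bounds -/

section

variable {V : Type*}

/-- The sign attached to `v` by a choice `ω` of Booleans. -/
def sgn (ω : V → Bool) (v : V) : ℝ := if ω v then 1 else -1

theorem abs_sgn (ω : V → Bool) (v : V) : |sgn ω v| = 1 := by
  cases h : ω v <;> simp [sgn, h]

variable [DecidableEq V]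

/-- Change the sign at `v`. -/
def flipAt (v : V) : (V → Bool) ≃ (V → Bool) :=
  Function.Involutive.toPerm (fun ω => Function.update ω v (!ω v)) fun ω => by simp

theorem sgn_flip_self (ω : V → Bool) (v : V) : sgn (flipAt v ω) v = -sgn ω v := by
  cases h : ω v <;> simp [sgn, flipAt, Function.Involutive.toPerm, h]

theorem sgn_flip_of_ne (ω : V → Bool) {v w : V} (h : w ≠ v) : sgn (flipAt v ω) w = sgn ω w := by
  simp [sgn, flipAt, Function.Involutive.toPerm, h]

variable [Fintype V]

theorem sum_eq_zero_of_flip (v : V) (g : (V → Bool) → ℝ) (h : ∀ ω, g (flipAt v ω) = -g ω) :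
    ∑ ω, g ω = 0 := by
  have h1 : ∑ ω, g (flipAt v ω) = ∑ ω, g ω := Equiv.sum_comp (flipAt v) g
  simp only [h, sum_neg_distrib] at h1
  linarith

theorem sum_sgn_mul_sgn {b c : V} (hbc : b ≠ c) : ∑ ω : V → Bool, sgn ω b * sgn ω c = 0 :=
  sum_eq_zero_of_flip b _ fun ω => by rw [sgn_flip_self, sgn_flip_of_ne _ hbc.symm, neg_mul]

theorem sum_sgn_pairs_eq_zero {b c d e : V} (hbc : b ≠ c) (hbd : b ≠ d) (hbe : b ≠ e) :
    ∑ ω : V → Bool, (sgn ω b * sgn ω c) * (sgn ω d * sgn ω e) = 0 :=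
  sum_eq_zero_of_flip b _ fun ω => by
    rw [sgn_flip_self, sgn_flip_of_ne _ hbc.symm, sgn_flip_of_ne _ hbd.symm,
      sgn_flip_of_ne _ hbe.symm]
    ring

/-- Either the two pairs coincide and the product is a square, or some sign occurs exactly once and
can be flipped. -/
theorem sum_sgn_pairs_nonneg {b c d e : V} (hbc : b ≠ c) (hde : d ≠ e) :
    0 ≤ ∑ ω : V → Bool, (sgn ω b * sgn ω c) * (sgn ω d * sgn ω e) := by
  by_cases hbd : b = d
  · by_cases hce : c = e
    · subst hbd hce
      exact sum_nonneg fun ω _ => mul_self_nonneg _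
    · refine (le_of_eq ?_)
      rw [← sum_sgn_pairs_eq_zero (e := e) hbc.symm (hbd ▸ hbc.symm) hce]
      exact sum_congr rfl fun ω _ => by ring
  · by_cases hbe : b = e
    · by_cases hcd : c = d
      · subst hbe hcd
        exact sum_nonneg fun ω _ => by
          rw [mul_comm (sgn ω c)]
          exact mul_self_nonneg _
      · refine (le_of_eq ?_)
        rw [← sum_sgn_pairs_eq_zero (d := d) hbc.symm hcd (hbe ▸ hbc.symm)]
        exact sum_congr rfl fun ω _ => by ring
    · exact (sum_sgn_pairs_eq_zero hbc hbd hbe).ge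

variable {β : Type*}

/-- Flipping the sign at `b p` negates the term of `p` and no other, so the terms behave as
independent signs. The points `c p` may coincide. -/
theorem sum_exp_sgn (b c : β → V) (P : Finset β) (hbc : ∀ p ∈ P, b p ≠ c p)
    (hP : ∀ p ∈ P, ∀ p' ∈ P, p ≠ p' → b p ≠ b p' ∧ b p ≠ c p') (r : ℝ) :
    ∑ ω : V → Bool, Real.exp (r * ∑ p ∈ P, sgn ω (b p) * sgn ω (c p)) =
      Real.cosh r ^ #P * Fintype.card (V → Bool) := by
  classical
  induction P using Finset.induction_on with
  | empty => simp
  | insert p P hp ih =>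
    have ih' := ih (fun p' h => hbc p' (mem_insert_of_mem h))
      (fun p' h p'' h' => hP p' (mem_insert_of_mem h) p'' (mem_insert_of_mem h'))
    set Q : (V → Bool) → ℝ := fun ω => ∑ p ∈ P, sgn ω (b p) * sgn ω (c p) with hQ
    have hflip : ∀ ω, Q (flipAt (b p) ω) = Q ω := fun ω => by
      refine sum_congr rfl fun p' hp' => ?_
      have := hP p (mem_insert_self _ _) p' (mem_insert_of_mem hp') fun h => hp (h ▸ hp')
      rw [sgn_flip_of_ne _ this.1.symm, sgn_flip_of_ne _ this.2.symm]
    have hs : ∀ ω, ∑ p ∈ insert p P, sgn ω (b p) * sgn ω (c p) =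
        sgn ω (b p) * sgn ω (c p) + Q ω := fun ω => sum_insert hp
    simp only [hs]
    have h1 : ∑ ω, Real.exp (r * (sgn ω (b p) * sgn ω (c p) + Q ω)) =
        ∑ ω, Real.exp (r * (-(sgn ω (b p) * sgn ω (c p)) + Q ω)) := by
      rw [← Equiv.sum_comp (flipAt (b p))]
      refine sum_congr rfl fun ω _ => ?_
      rw [hflip, sgn_flip_self, sgn_flip_of_ne _ (hbc p (mem_insert_self _ _)).symm, neg_mul]
    have h2 : ∑ ω, Real.exp (r * (sgn ω (b p) * sgn ω (c p) + Q ω)) +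
        ∑ ω, Real.exp (r * (-(sgn ω (b p) * sgn ω (c p)) + Q ω)) =
        ∑ ω, 2 * Real.cosh r * Real.exp (r * Q ω) := by
      rw [← sum_add_distrib]
      refine sum_congr rfl fun ω _ => ?_
      rw [mul_add, mul_add, Real.exp_add, Real.exp_add, ← add_mul]
      congr 1
      have : sgn ω (b p) * sgn ω (c p) = 1 ∨ sgn ω (b p) * sgn ω (c p) = -1 := by
        cases h : ω (b p) <;> cases h' : ω (c p) <;> simp [sgn, h, h']
      rw [Real.cosh_eq]
      rcases this with h | h <;> rw [h] <;> simp <;> ring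
    rw [← mul_sum, ih', ← h1] at h2
    rw [card_insert_of_notMem hp, pow_succ]
    linarith

/-- Markov's inequality for `exp (r * X)`. -/
theorem card_filter_lt_le (X : (V → Bool) → ℝ) {N L τ : ℝ} (hL : 0 < L) (hτ : 0 ≤ τ)
    (hX : ∀ r, ∑ ω, Real.exp (r * X ω) ≤ Real.exp (r ^ 2 / 2 * L) * N) :
    (#{ω | τ < X ω} : ℝ) ≤ Real.exp (-(τ ^ 2 / (2 * L))) * N := by
  -- `r = τ / L` minimises `r ^ 2 / 2 * L - r * τ`.
  have h1 : (#{ω | τ < X ω} : ℝ) * Real.exp (τ / L * τ) ≤ ∑ ω, Real.exp (τ / L * X ω) := by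
    rw [← nsmul_eq_mul, ← sum_const]
    refine (sum_le_sum fun ω hω => ?_).trans
      (sum_le_sum_of_subset_of_nonneg (filter_subset _ _) fun ω _ _ => (Real.exp_pos _).le)
    exact Real.exp_le_exp.2 (mul_le_mul_of_nonneg_left (mem_filter.1 hω).2.le (by positivity))
  have h2 := h1.trans (hX (τ / L))
  have e1 : Real.exp ((τ / L) ^ 2 / 2 * L) =
      Real.exp (-(τ ^ 2 / (2 * L))) * Real.exp (τ / L * τ) := by
    rw [← Real.exp_add]
    congr 1
    field_simp
    ring
  rw [e1, mul_right_comm] at h2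
  exact le_of_mul_le_mul_right h2 (Real.exp_pos _)

theorem card_abs_sum_sgn_gt_le (b c : β → V) (P : Finset β) (hbc : ∀ p ∈ P, b p ≠ c p)
    (hP : ∀ p ∈ P, ∀ p' ∈ P, p ≠ p' → b p ≠ b p' ∧ b p ≠ c p') {L τ : ℝ} (hL : 0 < L)
    (hPL : (#P : ℝ) ≤ L) (hτ : 0 ≤ τ) :
    (#{ω : V → Bool | τ < |∑ p ∈ P, sgn ω (b p) * sgn ω (c p)|} : ℝ) ≤
      2 * (Real.exp (-(τ ^ 2 / (2 * L))) * Fintype.card (V → Bool)) := by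
  have hX : ∀ r, ∑ ω : V → Bool, Real.exp (r * ∑ p ∈ P, sgn ω (b p) * sgn ω (c p)) ≤
      Real.exp (r ^ 2 / 2 * L) * Fintype.card (V → Bool) := fun r => by
    rw [sum_exp_sgn b c P hbc hP]
    refine mul_le_mul_of_nonneg_right ?_ (Nat.cast_nonneg _)
    calc Real.cosh r ^ #P ≤ Real.exp (r ^ 2 / 2) ^ #P :=
          pow_le_pow_left₀ (Real.cosh_pos r).le (Real.cosh_le_exp_half_sq r) _
      _ = Real.exp (r ^ 2 / 2 * #P) := by rw [← Real.exp_nat_mul, mul_comm]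
      _ ≤ _ := Real.exp_le_exp.2 (mul_le_mul_of_nonneg_left hPL (by positivity))
  have h1 := card_filter_lt_le _ hL hτ hX
  have h2 := card_filter_lt_le (N := Fintype.card (V → Bool)) (fun ω => -∑ p ∈ P, sgn ω (b p) * sgn ω (c p)) hL hτ fun r => by
    simpa only [neg_mul, mul_neg, neg_sq] using hX (-r)
  have h3 : (#{ω : V → Bool | τ < |∑ p ∈ P, sgn ω (b p) * sgn ω (c p)|} : ℝ) ≤
      #{ω : V → Bool | τ < ∑ p ∈ P, sgn ω (b p) * sgn ω (c p)} +
      #{ω : V → Bool | τ < -∑ p ∈ P, sgn ω (b p) * sgn ω (c p)} := by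
    simp only [lt_abs, filter_or]
    exact_mod_cast card_union_le _ _
  linarith

end

/-! ### Linear subfamilies and low-degree incidences -/

section

variable {V ι : Type*}

/-- Any two distinct triples of the family `J` share at most one vertex. -/
def IsLinear (a : ι → Fin 3 → V) (J : Finset ι) : Prop :=
  ∀ i ∈ J, ∀ j ∈ J, i ≠ j → ∀ k l k' l', a i k = a j k' → a i l = a j l' → k = l

/-- For `J` of maximum size, every triple contains one of the three pairs of some member of `J`, and
each pair lies in at most `D` triples. -/
theorem exists_isLinear [DecidableEq V] [Fintype ι] {a : ι → Fin 3 → V}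
    (ha : ∀ i, Function.Injective (a i)) {D : ℕ}
    (hD : ∀ u v, u ≠ v → #{i | (∃ k, a i k = u) ∧ ∃ l, a i l = v} ≤ D) :
    ∃ J, IsLinear a J ∧ Fintype.card ι ≤ #J * (3 * D) := by
  classical
  obtain ⟨J, hJ, hmax⟩ := exists_max_image ({J : Finset ι | IsLinear a J} : Finset (Finset ι)) card
    ⟨∅, mem_filter.2 ⟨mem_univ _, fun i hi => absurd hi (notMem_empty i)⟩⟩
  rw [mem_filter] at hJ
  refine ⟨J, hJ.2, ?_⟩
  have hfin : ∀ k l : Fin 3, k ≠ l → l = k + 1 ∨ k = l + 1 := by decide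
  have key : ∀ i, ∃ j ∈ J, ∃ k, (∃ k', a i k' = a j k) ∧ ∃ l', a i l' = a j (k + 1) := by
    intro i
    by_contra! h
    have hi : i ∉ J := fun hi => h i hi 0 ⟨0, rfl⟩ _ rfl
    have hc : ∀ j ∈ J, ∀ k l k' l', a i k = a j k' → a i l = a j l' → k' = l' := by
      intro j hj k l k' l' e1 e2
      by_contra hne
      rcases hfin _ _ hne with rfl | rfl
      · exact h j hj k' ⟨k, e1⟩ l e2
      · exact h j hj l' ⟨l, e2⟩ k e1
    have hlin : IsLinear a (insert i J) := by
      intro i1 h1 i2 h2 hne k l k' l' e1 e2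
      rcases mem_insert.1 h1 with rfl | g1
      · rcases mem_insert.1 h2 with rfl | g2
        · exact absurd rfl hne
        · have := hc i2 g2 k l k' l' e1 e2
          subst this
          exact ha _ (e1.trans e2.symm)
      · rcases mem_insert.1 h2 with rfl | g2
        · exact hc i1 g1 k' l' k l e1.symm e2.symm
        · exact hJ.2 i1 g1 i2 g2 hne k l k' l' e1 e2
    have := hmax (insert i J) (by simp [hlin])
    rw [card_insert_of_notMem hi] at this
    omega
  have hsub : (univ : Finset ι) ⊆ J.biUnion fun j => (univ : Finset (Fin 3)).biUnion fun k =>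
      {i | (∃ k', a i k' = a j k) ∧ ∃ l', a i l' = a j (k + 1)} := by
    intro i _
    obtain ⟨j, hj, k, hk⟩ := key i
    simp only [mem_biUnion, mem_filter, mem_univ, true_and]
    exact ⟨j, hj, k, hk⟩
  refine (card_le_card hsub).trans (card_biUnion_le_card_mul _ _ _ fun j _ => ?_)
  refine (card_biUnion_le_card_mul _ _ D fun k _ => ?_).trans (by simp)
  exact hD _ _ ((ha j).ne (by revert k; decide))

variable [DecidableEq V]

/-- The incidences of `J` at the vertex `u`. -/
def incidences (a : ι → Fin 3 → V) (J : Finset ι) (u : V) : Finset (ι × Fin 3) :=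
  {p ∈ J ×ˢ univ | a p.1 p.2 = u}

theorem mem_incidences {a : ι → Fin 3 → V} {J : Finset ι} {u : V} {p : ι × Fin 3} :
    p ∈ incidences a J u ↔ p.1 ∈ J ∧ a p.1 p.2 = u := by
  simp [incidences]

theorem card_incidences_le {a : ι → Fin 3 → V} (ha : ∀ i, Function.Injective (a i))
    (J : Finset ι) (u : V) : #(incidences a J u) ≤ #J := by
  refine card_le_card_of_injOn Prod.fst (fun p hp => (mem_incidences.1 hp).1) ?_
  rintro ⟨i, k⟩ hp ⟨j, l⟩ hp' (rfl : i = j)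
  rw [mem_coe, mem_incidences] at hp hp'
  exact Prod.ext rfl (ha i (hp.2.trans hp'.2.symm))

/-- Degrees sum to `3 * #J`, so at most `√#J` vertices are high. By linearity an ordered pair of
high vertices occurs in at most one triple, so there are at most `#J` such occurrences, and few
triples have several high vertices. -/
theorem card_low_incidences_ge [Fintype V] {a : ι → Fin 3 → V}
    (ha : ∀ i, Function.Injective (a i)) {J : Finset ι} (hJ : IsLinear a J) (hJ0 : 0 < #J) :
    (3 / 2 : ℝ) * #J ≤
      #{p ∈ J ×ˢ (univ : Finset (Fin 3)) | (#(incidences a J (a p.1 p.2)) : ℝ) ≤ 3 * √(#J)} := by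
  classical
  set L : ℝ := 3 * √(#J) with hL
  have hs : 0 < √(#J : ℝ) := Real.sqrt_pos.2 (by exact_mod_cast hJ0)
  have hss : √(#J : ℝ) * √(#J) = #J := Real.mul_self_sqrt (Nat.cast_nonneg _)
  set S : Finset V := {u | L < #(incidences a J u)} with hS
  have hsum : ∑ u, #(incidences a J u) = #J * 3 := by
    refine (card_eq_sum_card_fiberwise (s := J ×ˢ (univ : Finset (Fin 3)))
      (f := fun p => a p.1 p.2) (t := univ) (fun _ _ => mem_coe.2 (mem_univ _))).symm.trans ?_
    simp
  have hScard : (#S : ℝ) ≤ √(#J) := by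
    have h1 : (#S : ℝ) * L ≤ #J * 3 := by
      rw [← nsmul_eq_mul, ← sum_const]
      calc ∑ u ∈ S, L ≤ ∑ u ∈ S, (#(incidences a J u) : ℝ) :=
            sum_le_sum fun u hu => (mem_filter.1 hu).2.le
        _ ≤ ∑ u, (#(incidences a J u) : ℝ) :=
            sum_le_sum_of_subset_of_nonneg (subset_univ _) fun _ _ _ => Nat.cast_nonneg _
        _ = #J * 3 := by exact_mod_cast hsum
    have h2 : (#S : ℝ) * √(#J) ≤ √(#J) * √(#J) := by rw [hss]; rw [hL] at h1; linarith
    exact le_of_mul_le_mul_right h2 hs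
  let K : ι → Finset (Fin 3) := fun i => {k | a i k ∈ S}
  -- This is `(k - 1) * (k - 2) ≥ 0` with `k = #(K i)`.
  have hK : ∀ i, 2 * #(K i) ≤ 2 + #(K i).offDiag := fun i => by
    rw [offDiag_card]
    have : #(K i) ≤ 3 := (card_le_univ _).trans (by simp)
    interval_cases #(K i) <;> omega
  have hpairs : ∑ i ∈ J, #(K i).offDiag ≤ #S * #S := by
    rw [← card_sigma, ← card_product]
    refine card_le_card_of_injOn (fun p => (a p.1 p.2.1, a p.1 p.2.2)) ?_ ?_
    · rintro ⟨i, k, l⟩ h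
      simp only [coe_sigma, Set.mem_sigma_iff, mem_coe, mem_offDiag] at h
      simp only [mem_coe, mem_product]
      exact ⟨(mem_filter.1 h.2.1).2, (mem_filter.1 h.2.2.1).2⟩
    · rintro ⟨i, k, l⟩ h ⟨j, k', l'⟩ h' e
      simp only [coe_sigma, Set.mem_sigma_iff, mem_coe, mem_offDiag] at h h'
      simp only [Prod.mk.injEq] at e
      have hij : i = j := by
        by_contra hij
        exact h.2.2.2 (hJ i h.1 j h'.1 hij k l k' l' e.1 e.2)
      subst hij
      rw [ha i e.1, ha i e.2]
  have hhigh : 2 * ∑ i ∈ J, #(K i) ≤ 2 * #J + #S * #S := by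
    refine le_trans ?_ (Nat.add_le_add_left hpairs _)
    rw [mul_sum, mul_comm 2 (#J), ← smul_eq_mul (#J), ← sum_const, ← sum_add_distrib]
    exact sum_le_sum fun i _ => hK i
  have hsplit : #{p ∈ J ×ˢ (univ : Finset (Fin 3)) | (#(incidences a J (a p.1 p.2)) : ℝ) ≤ L} +
      ∑ i ∈ J, #(K i) = #J * 3 := by
    have h1 := card_filter_add_card_filter_not (s := J ×ˢ (univ : Finset (Fin 3)))
      (fun p => (#(incidences a J (a p.1 p.2)) : ℝ) ≤ L)
    have h2 : #{p ∈ J ×ˢ (univ : Finset (Fin 3)) | ¬ (#(incidences a J (a p.1 p.2)) : ℝ) ≤ L} =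
        ∑ i ∈ J, #(K i) := by
      rw [card_filter, sum_product]
      refine sum_congr rfl fun i _ => ?_
      simp only [K, S, card_filter, mem_filter, mem_univ, true_and, not_le]
    rw [h2] at h1
    simpa using h1
  have h3 : (#S : ℝ) * #S ≤ #J := by
    rw [← hss]
    exact mul_le_mul hScard hScard (Nat.cast_nonneg _) hs.le
  have h4 : (2 : ℝ) * ∑ i ∈ J, (#(K i) : ℝ) ≤ 2 * #J + #S * #S := by exact_mod_cast hhigh
  have h5 : (#{p ∈ J ×ˢ (univ : Finset (Fin 3)) | (#(incidences a J (a p.1 p.2)) : ℝ) ≤ L} : ℝ) +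
      ∑ i ∈ J, (#(K i) : ℝ) = #J * 3 := by exact_mod_cast hsplit
  linarith

end

/-! ### Link sums and the averaged lower bound -/

section

variable {V ι : Type*} [DecidableEq V]

/-- The product of the signs of the two vertices of the triple `p.1` other than `a p.1 p.2`. -/
def linkSgn (a : ι → Fin 3 → V) (ω : V → Bool) (p : ι × Fin 3) : ℝ :=
  sgn ω (a p.1 (p.2 + 1)) * sgn ω (a p.1 (p.2 + 2))

/-- The sum of the sign products over the link of `u` in `J`. -/
def linkSum (a : ι → Fin 3 → V) (J : Finset ι) (ω : V → Bool) (u : V) : ℝ :=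
  ∑ p ∈ incidences a J u, linkSgn a ω p

omit [DecidableEq V] in
theorem abs_linkSgn (a : ι → Fin 3 → V) (ω : V → Bool) (p : ι × Fin 3) : |linkSgn a ω p| = 1 := by
  rw [linkSgn, abs_mul, abs_sgn, abs_sgn, one_mul]

theorem abs_linkSum_le (a : ι → Fin 3 → V) (J : Finset ι) (ω : V → Bool) (u : V) :
    |linkSum a J ω u| ≤ #(incidences a J u) := by
  refine (abs_sum_le_sum_abs _ _).trans ?_
  simp [abs_linkSgn]

theorem fin_three_cyclic (k : Fin 3) : k + 1 ≠ k + 2 ∧ k + 1 ≠ k ∧ k + 2 ≠ k := by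
  revert k; decide

variable [Fintype V] {a : ι → Fin 3 → V}

theorem sum_linkSgn_mul_nonneg (ha : ∀ i, Function.Injective (a i)) (p p' : ι × Fin 3) :
    0 ≤ ∑ ω, linkSgn a ω p * linkSgn a ω p' :=
  sum_sgn_pairs_nonneg ((ha _).ne (fin_three_cyclic _).1) ((ha _).ne (fin_three_cyclic _).1)

/-- A nonzero correlation needs equal link pairs; linearity then makes the triples equal, hence also
their remaining vertices. -/
theorem sum_linkSgn_mul_eq_zero (ha : ∀ i, Function.Injective (a i)) {J : Finset ι}
    (hJ : IsLinear a J) {p p' : ι × Fin 3} (hp : p.1 ∈ J) (hp' : p'.1 ∈ J)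
    (hne : a p.1 p.2 ≠ a p'.1 p'.2) : ∑ ω, linkSgn a ω p * linkSgn a ω p' = 0 := by
  obtain ⟨i, k⟩ := p
  obtain ⟨j, l⟩ := p'
  dsimp only at hp hp' hne
  have hk : a i (k + 1) ≠ a i (k + 2) := (ha i).ne (fin_three_cyclic k).1
  simp only [linkSgn]
  by_cases h1 : a i (k + 1) ≠ a j (l + 1) ∧ a i (k + 1) ≠ a j (l + 2)
  · exact sum_sgn_pairs_eq_zero hk h1.1 h1.2
  by_cases h2 : a i (k + 2) ≠ a j (l + 1) ∧ a i (k + 2) ≠ a j (l + 2)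
  · rw [← sum_sgn_pairs_eq_zero hk.symm h2.1 h2.2]
    exact sum_congr rfl fun ω _ => by ring
  exfalso
  have hs : ∃ s, s ≠ l ∧ a i (k + 1) = a j s := by
    rw [not_and_or, not_not, not_not] at h1
    exact h1.elim (fun h => ⟨_, (fin_three_cyclic l).2.1, h⟩)
      fun h => ⟨_, (fin_three_cyclic l).2.2, h⟩
  have ht : ∃ t, t ≠ l ∧ a i (k + 2) = a j t := by
    rw [not_and_or, not_not, not_not] at h2
    exact h2.elim (fun h => ⟨_, (fin_three_cyclic l).2.1, h⟩)
      fun h => ⟨_, (fin_three_cyclic l).2.2, h⟩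
  obtain ⟨s, hs, es⟩ := hs
  obtain ⟨t, ht, et⟩ := ht
  by_cases hij : i = j
  · subst hij
    have h1 := ha i es
    have h2 := ha i et
    subst h1 h2
    have : ∀ k l : Fin 3, k + 1 ≠ l → k + 2 ≠ l → k = l := by decide
    exact hne (by rw [this k l hs ht])
  · exact (fin_three_cyclic k).1 (hJ i hp j hp' hij _ _ _ _ es et)

theorem sum_linkSum_mul_linkSum (ha : ∀ i, Function.Injective (a i)) {J : Finset ι}
    (hJ : IsLinear a J) {u v : V} (huv : u ≠ v) :
    ∑ ω, linkSum a J ω u * linkSum a J ω v = 0 := by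
  simp only [linkSum, sum_mul_sum]
  rw [sum_comm]
  refine sum_eq_zero fun p hp => ?_
  rw [sum_comm]
  refine sum_eq_zero fun p' hp' => ?_
  rw [mem_incidences] at hp hp'
  exact sum_linkSgn_mul_eq_zero ha hJ hp.1 hp'.1 (by rwa [hp.2, hp'.2])

theorem sum_linkSum_mul_linkSgn_nonneg (ha : ∀ i, Function.Injective (a i)) (J : Finset ι)
    (u : V) (p : ι × Fin 3) : 0 ≤ ∑ ω, linkSum a J ω u * linkSgn a ω p := by
  simp only [linkSum, sum_mul]
  rw [sum_comm]
  exact sum_nonneg fun p' _ => sum_linkSgn_mul_nonneg ha p' p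

theorem sum_linkSum_mul_linkSgn_ge (ha : ∀ i, Function.Injective (a i)) {J : Finset ι}
    {p : ι × Fin 3} (hp : p.1 ∈ J) :
    (Fintype.card (V → Bool) : ℝ) ≤ ∑ ω, linkSum a J ω (a p.1 p.2) * linkSgn a ω p := by
  simp only [linkSum, sum_mul]
  rw [sum_comm]
  calc (Fintype.card (V → Bool) : ℝ) = ∑ ω, linkSgn a ω p * linkSgn a ω p := by
        simp only [← abs_mul_abs_self (linkSgn a _ p), abs_linkSgn]
        simp
    _ ≤ _ := single_le_sum (f := fun p' => ∑ ω, linkSgn a ω p' * linkSgn a ω p)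
        (fun p' _ => sum_linkSgn_mul_nonneg ha p' p) (mem_incidences.2 ⟨hp, rfl⟩)

/-- Triples of a linear family through `u` meet only in `u`, so the link pairs are disjoint and the
sub-Gaussian bound applies. -/
theorem card_linkSum_gt_le (ha : ∀ i, Function.Injective (a i)) {J : Finset ι}
    (hJ : IsLinear a J) (u : V) {L τ : ℝ} (hL : 0 < L) (hu : (#(incidences a J u) : ℝ) ≤ L)
    (hτ : 0 ≤ τ) :
    (#{ω : V → Bool | τ < |linkSum a J ω u|} : ℝ) ≤
      2 * (Real.exp (-(τ ^ 2 / (2 * L))) * Fintype.card (V → Bool)) := by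
  refine card_abs_sum_sgn_gt_le (fun p : ι × Fin 3 => a p.1 (p.2 + 1)) (fun p => a p.1 (p.2 + 2))
    (incidences a J u) (fun p _ => (ha _).ne (fin_three_cyclic _).1) ?_ hL hu hτ
  rintro ⟨i, k⟩ hp ⟨j, l⟩ hp' hne
  rw [mem_incidences] at hp hp'
  dsimp only at hp hp' ⊢
  by_cases hij : i = j
  · subst hij
    exact absurd (by rw [ha i (hp.2.trans hp'.2.symm)]) hne
  · have : ∀ t, a i (k + 1) ≠ a j t := fun t e =>
      (fin_three_cyclic k).2.1 (hJ i hp.1 j hp'.1 hij _ _ _ _ e (hp.2.trans hp'.2.symm))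
    exact ⟨this _, this _⟩

theorem le_surplus_of_isLinear [Fintype ι] (ha : ∀ i, Function.Injective (a i)) {J : Finset ι}
    (hJ : IsLinear a J) (hJ0 : 0 < #J) {M : ℝ}
    (hM : ∀ f, (cutSize a f : ℝ) - 2 / 9 * Fintype.card ι ≤ M) {T : ℝ} (hT : 1 ≤ T) :
    #J / (18 * T) - 18 * (Fintype.card ι : ℝ) ^ 4 * Real.exp (-(T ^ 2 / (216 * √(#J)))) ≤ M := by
  classical
  have hT0 : 0 < T := by linarith
  set m : ℝ := (Fintype.card ι : ℝ) with hm
  set N : ℝ := (Fintype.card (V → Bool) : ℝ) with hN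
  have hN0 : 0 < N := by rw [hN]; exact_mod_cast Fintype.card_pos
  have hJm : (#J : ℝ) ≤ m := by rw [hm]; exact_mod_cast card_le_univ J
  have hm1 : 1 ≤ m := le_trans (by exact_mod_cast hJ0) hJm
  set L : ℝ := 3 * √(#J) with hL
  have hL0 : 0 < L := mul_pos three_pos (Real.sqrt_pos.2 (by exact_mod_cast hJ0))
  let low : V → Prop := fun u => (#(incidences a J u) : ℝ) ≤ L
  let q : (V → Bool) → V → ℝ := fun ω u => if low u then linkSum a J ω u / T else 0
  let R : (V → Bool) → ℝ := fun ω =>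
    (1 / 27) * ∑ i, ∑ k, q ω (a i k) * linkSgn a ω (i, k) -
      (2 / 3) * ∑ i, ∑ k, q ω (a i (k + 1)) * q ω (a i (k + 2))
  -- Indexing by incidences of `J` makes the union bound independent of the number of vertices; a
  -- vertex outside `J` has link sum zero.
  let bad : Finset (V → Bool) :=
    (J ×ˢ (univ : Finset (Fin 3))).biUnion fun p =>
      {ω | low (a p.1 p.2) ∧ T / 6 < |linkSum a J ω (a p.1 p.2)|}
  -- For bad `ω` the form is used with `q = 0`. The `xx` term is kept for every `ω`, so that it
  -- still averages to zero.
  have hform : ∀ ω, -(1 / 54) * ∑ i, ∑ k, linkSgn a ω (i, k) + (if ω ∈ bad then 0 else R ω) ≤ M := by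
    intro ω
    by_cases hω : ω ∈ bad
    · rw [if_pos hω]
      simpa [linkSgn] using surplus_ge_form ha hM (sgn ω) 0 (fun v => (abs_sgn ω v).le) (by simp)
    · rw [if_neg hω]
      refine surplus_ge_form ha hM (sgn ω) (q ω) (fun v => (abs_sgn ω v).le) fun v => ?_
      by_cases hv : low v
      · simp only [q, if_pos hv]
        rw [abs_div, abs_of_pos hT0, div_le_iff₀ hT0]
        rcases (incidences a J v).eq_empty_or_nonempty with he | ⟨p, hp⟩
        · simp only [linkSum, he, sum_empty, abs_zero]; positivity
        · rw [mem_incidences] at hp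
          by_contra hlt
          refine hω (mem_biUnion.2 ⟨p, by simp [hp.1], mem_filter.2 ⟨mem_univ _, ?_⟩⟩)
          rw [hp.2]
          exact ⟨hv, by linarith⟩
      · simp [q, hv]
  have hq : ∀ ω u, |q ω u| ≤ m := fun ω u => by
    by_cases hu : low u
    · simp only [q, if_pos hu]
      rw [abs_div, abs_of_pos hT0, div_le_iff₀ hT0]
      have h1 : (#(incidences a J u) : ℝ) ≤ #J := by exact_mod_cast card_incidences_le ha J u
      nlinarith [abs_linkSum_le a J ω u]
    · simp only [q, if_neg hu, abs_zero]; linarith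
  have hR : ∀ ω, |R ω| ≤ 3 * m ^ 3 := fun ω => by
    have h1 : |∑ i, ∑ k, q ω (a i k) * linkSgn a ω (i, k)| ≤ m * (3 * m) := by
      refine (abs_sum_le_sum_abs _ _).trans ((sum_le_card_nsmul _ _ (3 * m) fun i _ => ?_).trans ?_)
      · refine (abs_sum_le_sum_abs _ _).trans ((sum_le_card_nsmul _ _ m fun k _ => ?_).trans ?_)
        · rw [abs_mul, abs_linkSgn, mul_one]; exact hq _ _
        · simp
      · simp [hm]
    have h2 : |∑ i, ∑ k, q ω (a i (k + 1)) * q ω (a i (k + 2))| ≤ m * (3 * (m * m)) := by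
      refine (abs_sum_le_sum_abs _ _).trans
        ((sum_le_card_nsmul _ _ (3 * (m * m)) fun i _ => ?_).trans ?_)
      · refine (abs_sum_le_sum_abs _ _).trans
          ((sum_le_card_nsmul _ _ (m * m) fun k _ => ?_).trans ?_)
        · rw [abs_mul]
          exact mul_le_mul (hq _ _) (hq _ _) (abs_nonneg _) (by linarith)
        · simp
      · simp [hm]
    have h3 : m ^ 2 ≤ m ^ 3 := pow_le_pow_right₀ hm1 (by norm_num)
    rw [abs_le] at h1 h2 ⊢
    simp only [R]
    constructor <;> nlinarith
  have hsumR : N * (#J / (18 * T)) ≤ ∑ ω, R ω := by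
    simp only [R]
    rw [sum_sub_distrib, ← mul_sum, ← mul_sum]
    have h1 : ∑ ω, ∑ i, ∑ k, q ω (a i (k + 1)) * q ω (a i (k + 2)) = 0 := by
      rw [sum_comm]
      refine sum_eq_zero fun i _ => ?_
      rw [sum_comm]
      refine sum_eq_zero fun k _ => ?_
      by_cases hu : low (a i (k + 1))
      · by_cases hv : low (a i (k + 2))
        · simp only [q, if_pos hu, if_pos hv, div_mul_div_comm]
          rw [← sum_div, sum_linkSum_mul_linkSum ha hJ ((ha i).ne (fin_three_cyclic k).1), zero_div]
        · simp [q, hv]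
      · simp [q, hu]
    have h2 : N * (3 / 2 * #J / T) ≤ ∑ ω, ∑ i, ∑ k, q ω (a i k) * linkSgn a ω (i, k) := by
      calc N * (3 / 2 * #J / T)
          ≤ N * (#{p ∈ J ×ˢ (univ : Finset (Fin 3)) | low (a p.1 p.2)} / T) := by
            have := card_low_incidences_ge ha hJ hJ0
            gcongr
        _ = ∑ p ∈ J ×ˢ (univ : Finset (Fin 3)) with low (a p.1 p.2), N / T := by
            rw [sum_const, nsmul_eq_mul]; ring
        _ ≤ ∑ p ∈ J ×ˢ (univ : Finset (Fin 3)) with low (a p.1 p.2),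
              ∑ ω, q ω (a p.1 p.2) * linkSgn a ω p := by
            refine sum_le_sum fun p hp => ?_
            rw [mem_filter, mem_product] at hp
            simp only [q, if_pos hp.2, div_mul_eq_mul_div]
            rw [← sum_div]
            exact div_le_div_of_nonneg_right (sum_linkSum_mul_linkSgn_ge ha hp.1.1) hT0.le
        -- The added incidences, including those of triples outside `J`, have nonnegative
        -- correlation.
        _ ≤ ∑ p : ι × Fin 3, ∑ ω, q ω (a p.1 p.2) * linkSgn a ω p := by
            refine sum_le_sum_of_subset_of_nonneg (subset_univ _) fun p _ _ => ?_
            by_cases hu : low (a p.1 p.2)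
            · simp only [q, if_pos hu, div_mul_eq_mul_div]
              rw [← sum_div]
              exact div_nonneg (sum_linkSum_mul_linkSgn_nonneg ha J _ p) hT0.le
            · simp [q, hu]
        _ = _ := by
            rw [sum_comm]
            exact sum_congr rfl fun ω _ => Fintype.sum_prod_type _
    rw [h1]
    have e : N * (#J / (18 * T)) = 1 / 27 * (N * (3 / 2 * #J / T)) := by field_simp; norm_num
    rw [e]
    linarith
  have hbad : (#bad : ℝ) ≤ 6 * m * (Real.exp (-(T ^ 2 / (216 * √(#J)))) * N) := by
    have h1 : (#bad : ℝ) ≤ ∑ p ∈ J ×ˢ (univ : Finset (Fin 3)),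
        (#{ω : V → Bool | low (a p.1 p.2) ∧ T / 6 < |linkSum a J ω (a p.1 p.2)|} : ℝ) := by
      exact_mod_cast card_biUnion_le
    have e : (T / 6) ^ 2 / (2 * L) = T ^ 2 / (216 * √(#J)) := by rw [hL]; field_simp; norm_num
    have h2 : ∀ p ∈ J ×ˢ (univ : Finset (Fin 3)),
        (#{ω : V → Bool | low (a p.1 p.2) ∧ T / 6 < |linkSum a J ω (a p.1 p.2)|} : ℝ) ≤
          2 * (Real.exp (-(T ^ 2 / (216 * √(#J)))) * N) := by
      intro p _
      by_cases hu : low (a p.1 p.2)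
      · simp only [hu, true_and]
        rw [← e]
        exact card_linkSum_gt_le ha hJ _ hL0 hu (by positivity)
      · simp only [hu, false_and, filter_false, card_empty, Nat.cast_zero]; positivity
    refine h1.trans ((sum_le_card_nsmul _ _ _ h2).trans ?_)
    rw [card_product, card_univ, Fintype.card_fin, nsmul_eq_mul]
    push_cast
    have : 0 ≤ Real.exp (-(T ^ 2 / (216 * √(#J)))) * N := by positivity
    nlinarith
  have htotal : ∑ ω, R ω - #bad * (3 * m ^ 3) ≤ N * M := by
    have h1 := sum_le_sum fun ω (_ : ω ∈ (univ : Finset (V → Bool))) => hform ω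
    have h0 : ∑ ω, ∑ i, ∑ k, linkSgn a ω (i, k) = 0 := by
      rw [sum_comm]
      refine sum_eq_zero fun i _ => ?_
      rw [sum_comm]
      exact sum_eq_zero fun k _ => sum_sgn_mul_sgn ((ha i).ne (fin_three_cyclic k).1)
    rw [sum_add_distrib, ← mul_sum, h0, mul_zero, zero_add, sum_const, card_univ, nsmul_eq_mul] at h1
    refine le_trans ?_ h1
    have h2 : ∑ ω, R ω - ∑ ω, (if ω ∈ bad then R ω else 0) = ∑ ω, (if ω ∈ bad then 0 else R ω) := by
      rw [← sum_sub_distrib]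
      exact sum_congr rfl fun ω _ => by split_ifs <;> simp
    rw [← h2]
    refine sub_le_sub_left ?_ _
    rw [sum_ite_mem, univ_inter, ← nsmul_eq_mul]
    exact sum_le_card_nsmul _ _ _ fun ω _ => (le_abs_self _).trans (hR ω)
  have hfin : N * (#J / (18 * T) - 18 * m ^ 4 * Real.exp (-(T ^ 2 / (216 * √(#J))))) ≤ N * M := by
    refine le_trans ?_ htotal
    have := mul_le_mul_of_nonneg_right hbad (show 0 ≤ 3 * m ^ 3 by positivity)
    nlinarith
  exact le_of_mul_le_mul_left hfin hN0

end

/-! ### Choice of the scale `T` -/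

/-- The argument loses only `√(log m)`; this weakens it to the stated `(log m) ^ 2`. -/
theorem sqrt_le_two_mul_sq {l : ℝ} (hl : Real.log 2 ≤ l) : √l ≤ 2 * l ^ 2 := by
  have h2 : (0.69 : ℝ) ≤ l := by linarith [Real.log_two_gt_d9]
  rw [Real.sqrt_le_left (by positivity)]
  have h3 : (0.69 : ℝ) ^ 3 ≤ l ^ 3 := pow_le_pow_left₀ (by norm_num) h2 3
  have h4 : (0.69 : ℝ) ^ 3 * l ≤ l ^ 3 * l := mul_le_mul_of_nonneg_right h3 (by linarith)
  nlinarith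

theorem le_of_forall_scale {M : ℝ} {n m D : ℕ} (hn : 0 < n) (hm : 2 ≤ m) (hnm : n ≤ m)
    (hmn : m ≤ n * (3 * D))
    (hM : ∀ T : ℝ, 1 ≤ T →
      n / (18 * T) - 18 * (m : ℝ) ^ 4 * Real.exp (-(T ^ 2 / (216 * √n))) ≤ M) :
    1 / 15552 * ((m : ℝ) ^ (3 / 4 : ℝ) / ((D : ℝ) ^ (3 / 4 : ℝ) * (Real.log m) ^ 2)) ≤ M := by
  have hm2 : (2 : ℝ) ≤ m := by exact_mod_cast hm
  have hn1 : (1 : ℝ) ≤ n := by exact_mod_cast hn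
  have hnm' : (n : ℝ) ≤ m := by exact_mod_cast hnm
  have hD : 0 < D := by
    rcases Nat.eq_zero_or_pos D with rfl | h
    · simp at hmn; omega
    · exact h
  have hD' : (0 : ℝ) < D := by exact_mod_cast hD
  set l := Real.log m with hl
  have hl2 : Real.log 2 ≤ l := Real.log_le_log two_pos hm2
  have hl0 : (0.69 : ℝ) ≤ l := by linarith [Real.log_two_gt_d9]
  have hlm : l ≤ m := by linarith [Real.log_le_sub_one_of_pos (show (0 : ℝ) < m by linarith)]
  have hsn : 1 ≤ √(n : ℝ) := Real.one_le_sqrt.2 hn1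
  have hsn' : √(n : ℝ) ≤ n := by
    rw [Real.sqrt_le_left (by linarith)]
    nlinarith
  set s := √√(n : ℝ) with hs
  have hs1 : 1 ≤ s := Real.one_le_sqrt.2 hsn
  have hs2 : s ^ 2 = √n := Real.sq_sqrt (by linarith)
  have hs4 : s ^ 4 = n := by
    rw [show s ^ 4 = (s ^ 2) ^ 2 by ring, hs2, Real.sq_sqrt (by linarith)]
  -- The factor 72 makes the exponent `T ^ 2 / (216 * √n)` equal to `24 * log m`, so the error is
  -- `18 / m ^ 20`, at most half of the main term.
  set T : ℝ := 72 * (s * √l) with hT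
  have hT2 : T ^ 2 = 5184 * (√n * l) := by
    rw [hT, mul_pow, mul_pow, hs2, Real.sq_sqrt (by linarith)]; norm_num
  have hT0 : 0 < T := by
    have : 0 < √l := Real.sqrt_pos.2 (by linarith)
    positivity
  have hT1 : 1 ≤ T := by
    rw [← one_le_sq_iff₀ hT0.le, hT2]
    nlinarith
  have hTm : T ≤ 72 * m := by
    refine le_of_sq_le_sq ?_ (by linarith)
    rw [hT2, mul_pow]
    have : √n * l ≤ m * m := mul_le_mul (hsn'.trans hnm') hlm (by linarith) (by linarith)
    nlinarith
  have hexp : Real.exp (-(T ^ 2 / (216 * √n))) = ((m : ℝ) ^ 24)⁻¹ := by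
    have e : T ^ 2 / (216 * √n) = (24 : ℕ) * l := by
      rw [hT2]
      have : √(n : ℝ) ≠ 0 := by linarith
      field_simp
      norm_num
    rw [e, Real.exp_neg, Real.exp_nat_mul, hl, Real.exp_log (by linarith)]
  have herr : 18 * (m : ℝ) ^ 4 * ((m : ℝ) ^ 24)⁻¹ ≤ n / (36 * T) := by
    have e : 18 * (m : ℝ) ^ 4 * ((m : ℝ) ^ 24)⁻¹ = 18 / (m : ℝ) ^ 20 := by
      have : (m : ℝ) ≠ 0 := by linarith
      field_simp
    rw [e, div_le_div_iff₀ (by positivity) (by positivity)]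
    have h1 : (2 : ℝ) ^ 19 ≤ (m : ℝ) ^ 19 := pow_le_pow_left₀ two_pos.le hm2 19
    calc 18 * (36 * T) ≤ 18 * (36 * (72 * m)) := by linarith
      _ ≤ (m : ℝ) ^ 19 * m := by nlinarith
      _ = 1 * (m : ℝ) ^ 20 := by ring
      _ ≤ n * (m : ℝ) ^ 20 := mul_le_mul_of_nonneg_right hn1 (by positivity)
  have hmain : n / (36 * T) ≤ M := by
    have h1 := hM T hT1
    rw [hexp] at h1
    have e : n / (18 * T) = n / (36 * T) + n / (36 * T) := by field_simp; norm_num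
    linarith
  refine le_trans ?_ hmain
  have hpow : (m : ℝ) ^ (3 / 4 : ℝ) / (D : ℝ) ^ (3 / 4 : ℝ) ≤ 3 * s ^ 3 := by
    rw [div_le_iff₀ (Real.rpow_pos_of_pos hD' _)]
    have h1 : (m : ℝ) ≤ 3 * n * D := by
      have : (m : ℝ) ≤ n * (3 * D) := by exact_mod_cast hmn
      linarith
    have h2 : (n : ℝ) ^ (3 / 4 : ℝ) = s ^ 3 := by
      rw [← hs4, ← Real.rpow_natCast, ← Real.rpow_natCast, ← Real.rpow_mul (by linarith)]
      norm_num
    calc (m : ℝ) ^ (3 / 4 : ℝ) ≤ (3 * n * D : ℝ) ^ (3 / 4 : ℝ) :=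
          Real.rpow_le_rpow (by linarith) h1 (by norm_num)
      _ = 3 ^ (3 / 4 : ℝ) * s ^ 3 * (D : ℝ) ^ (3 / 4 : ℝ) := by
          rw [Real.mul_rpow (by positivity) hD'.le, Real.mul_rpow (by norm_num) (by linarith), h2]
      _ ≤ 3 ^ (1 : ℝ) * s ^ 3 * (D : ℝ) ^ (3 / 4 : ℝ) := by
          have : (3 : ℝ) ^ (3 / 4 : ℝ) ≤ 3 ^ (1 : ℝ) :=
            Real.rpow_le_rpow_of_exponent_le (by norm_num) (by norm_num)
          gcongr
      _ = _ := by rw [Real.rpow_one]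
  have hsl : 0 < √l := Real.sqrt_pos.2 (by linarith)
  calc 1 / 15552 * ((m : ℝ) ^ (3 / 4 : ℝ) / ((D : ℝ) ^ (3 / 4 : ℝ) * l ^ 2))
      = 1 / 15552 * ((m : ℝ) ^ (3 / 4 : ℝ) / (D : ℝ) ^ (3 / 4 : ℝ)) / l ^ 2 := by
        rw [← div_div, mul_div_assoc]
    _ ≤ 1 / 15552 * (3 * s ^ 3) / (√l / 2) := by
        gcongr
        linarith [sqrt_le_two_mul_sq hl2]
    _ = n / (36 * T) := by
        rw [← hs4, hT]
        have : s ≠ 0 := by linarith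
        field_simp
        norm_num

theorem le_surplus {V ι : Type*} [Fintype V] [DecidableEq V] [Fintype ι] {a : ι → Fin 3 → V}
    (ha : ∀ i, Function.Injective (a i)) {D : ℕ}
    (hD : ∀ u v, u ≠ v → #{i | (∃ k, a i k = u) ∧ ∃ l, a i l = v} ≤ D)
    (hι : 2 ≤ Fintype.card ι) {M : ℝ}
    (hM : ∀ f, (cutSize a f : ℝ) - 2 / 9 * Fintype.card ι ≤ M) :
    1 / 15552 * ((Fintype.card ι : ℝ) ^ (3 / 4 : ℝ) /
      ((D : ℝ) ^ (3 / 4 : ℝ) * (Real.log (Fintype.card ι)) ^ 2)) ≤ M := by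
  obtain ⟨J, hJ, hc⟩ := exists_isLinear ha hD
  have hJ0 : 0 < #J := by
    rcases Nat.eq_zero_or_pos (#J) with h | h
    · rw [h] at hc; omega
    · exact h
  exact le_of_forall_scale hJ0 hι (card_le_univ J) hc
    fun T hT => le_surplus_of_isLinear ha hJ hJ0 hM hT

end ThreeCut

/-! ### Transfer to hypergraphs -/

namespace Hypergraph

variable {α : Type*} {H : Hypergraph α}

theorem IsUniform.exists_enum (hH : H.IsUniform 3) (e : H.edgeSet) :
    ∃ b : Fin 3 → H.vertexSet, Function.Injective b ∧ ∀ v : α, v ∈ e.1 ↔ ∃ k, (b k : α) = v := by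
  obtain ⟨x, y, z, hxy, hxz, hyz, he⟩ := Set.ncard_eq_three.1 (hH e.1 e.2)
  have hsub := H.subset_vertexSet_of_mem_edgeSet' e.2
  refine ⟨![⟨x, hsub (by simp [he])⟩, ⟨y, hsub (by simp [he])⟩, ⟨z, hsub (by simp [he])⟩], ?_, ?_⟩
  · intro i j hij
    fin_cases i <;> fin_cases j <;> simp_all
  · intro v
    simp [he, Fin.exists_fin_succ, eq_comm]

theorem ncard_sep_edgeSet [Fintype H.edgeSet] (p : Set α → Prop) [DecidablePred p] :
    {e ∈ H.edgeSet | p e}.ncard = (Finset.univ.filter fun e : H.edgeSet => p e.1).card := by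
  rw [← Set.ncard_coe_finset, ← Set.ncard_image_of_injective _ Subtype.val_injective]
  congr 1
  ext e
  simp [and_comm]

end Hypergraph

theorem mainTheorem6 :
    ∃ c : ℝ, 0 < c ∧
      ∀ (α : Type*) (H : Hypergraph α), H.vertexSet.Finite → H.IsUniform 3 →
        ∀ m D : ℕ, H.numEdges = m → 2 ≤ m → H.maxCodegree = D →
          c * ((m : ℝ) ^ (3 / 4 : ℝ) / ((D : ℝ) ^ (3 / 4 : ℝ) * (Real.log (m : ℝ)) ^ 2)) ≤
            H.surplus 3 3 := by
  refine ⟨1 / 15552, by norm_num, ?_⟩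
  intro α H hV hH m D hm hm2 hD
  classical
  have : Fintype H.vertexSet := hV.fintype
  have : Fintype H.edgeSet := (Hypergraph.finite_edgeSet hV).fintype
  choose a ha hmem using hH.exists_enum
  have hcard : Fintype.card H.edgeSet = m := by
    rw [← hm, Hypergraph.numEdges, Set.ncard_eq_toFinset_card', Set.toFinset_card]
  rw [← hcard] at hm2 ⊢
  refine ThreeCut.le_surplus ha ?_ hm2 ?_
  · intro u v huv
    rw [← hD]
    refine le_trans (le_of_eq ?_) (Hypergraph.codegree_le_maxCodegree hV u.2 v.2
      fun h => huv (Subtype.ext h))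
    rw [Hypergraph.codegree, Hypergraph.ncard_sep_edgeSet]
    congr 1
    ext e
    simp only [Finset.mem_filter, hmem, Subtype.ext_iff]
  · intro f
    -- The default colour is harmless, since edges lie inside the vertex set.
    let g : α → Fin 3 := fun v => if h : v ∈ H.vertexSet then f ⟨v, h⟩ else 0
    have hg : ∀ v : H.vertexSet, g v = f v := fun v => by simp [g]
    have hcut : (H.cutEdges g).ncard = ThreeCut.cutSize a f := by
      rw [Hypergraph.cutEdges, Hypergraph.ncard_sep_edgeSet, ThreeCut.cutSize]
      congr 1
      ext e
      rw [Finset.mem_filter, Finset.mem_filter]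
      simp only [hmem, Function.Surjective, Function.comp_apply,
        exists_exists_eq_and, hg, Finset.mem_univ, true_and]
    have hle : (ThreeCut.cutSize a f : ℝ) ≤ H.maxCut 3 := by
      rw [← hcut]
      exact_mod_cast Hypergraph.ncard_cutEdges_le_maxCut hV g
    have hst : ((Nat.stirlingSecond 3 3 : ℝ) * (Nat.factorial 3 : ℝ) / ((3 : ℕ) : ℝ) ^ 3) = 2 / 9 := by
      rw [Nat.stirlingSecond_self]
      norm_num [Nat.factorial]
    rw [Hypergraph.surplus, hst, Hypergraph.numEdges, Set.ncard_eq_toFinset_card',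
      Set.toFinset_card]
    linarith
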